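/- **Setting.** The two-sorted language of bounded arithmetic has number terms built from $0,s,+,\cdot,|X|$ and relations $\le$, $X(t)$ (also written $t\in X$), and equality for both sorts. $\Sigma^B_0$ formulas are those whose only quantifiers are bounded number quantifiers. $V^0$ is the theory 2-BASIC (the Cook–Nguyen basic axioms, including the length axioms and extensionality) plus comprehension $\exists Y\,(|Y|\le a\wedge\forall z<a\,(Y(z)\leftrightarrow\varphi(z)))$ for all $\Sigma^B_0$ formulas $\varphi$ (with parameters, $Y$ not free in $\varphi$); $VP=V^0+MCV$, where $MCV$ is the monotone circuit value axiom. Let $\mathcal M=(M_0,M)$ be a countable nonstandard model of $VP+\neg Exp$ (numbers $M_0$, strings $M$), where $Exp$ says that $a\mapsto 2^a$ is total on numbers. "Definable" means definable in $\mathcal M$ by a formula with parameters. **Boolean algebra in $M$.** $\mathbb B$ is a Boolean algebra whose elements are represented by the strings of a definable class, such that the relation "$X,Y$ represent elements of $\mathbb B$ and the element of $X$ is $\le$ the element of $Y$" is definable. $M^{\mathbb B}$ is the set of functions $A:\{i\in M_0:i<a\}\to\mathbb B$, $a\in M_0$ (written $A:a\to\mathbb B$), coded in $M$, i.e. such that for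 some string $S\in M$ each row $\{j:\langle i,j\rangle\in S\}$, $i<a$, is a string of $M$ representing $A(i)$. Put $A(i)=0$ for $i\ge a$. **Translation.** For $A:a\to\mathbb B$ let $[\![|A|=\ell]\!]$ be the meet of $\neg A(j)$, $\ell\le j<a$, and, if $\ell=k+1$, of $A(k)$. For a $\Sigma^B_0$ formula $\varphi$ with number parameters from $M_0$ and string parameters $A_i:a_i\to\mathbb B$ from $M^{\mathbb B}$, the value $[\![\varphi]\!]\in\mathbb B$ of its propositional translation is defined recursively, if all joins and meets involved exist: an atomic formula in number terms without strings has value $1$ or $0$ according to its truth in $M_0$; $[\![t\in A]\!]=A(t)$; if lengths $|A_1|,\dots,|A_k|$ occur in the terms of an atomic formula $\alpha$, then $[\![\alpha]\!]=\bigvee_{\ell_1\le a_1,\dots,\ell_k\le a_k}\bigl(\bigwedge_i[\![|A_i|=\ell_i]\!]\wedge[\![\alpha(\ell_1,\dots,\ell_k)]\!]\bigr)$, where $\alpha(\bar\ell)$ has $\ell_i$ in place of $|A_i|$; for $A:a\to\mathbb B$ and $C:c\to\mathbb B$, $[\![A=C]\!]=\bigwedge_{j<\max(a,c)}(A(j)\leftrightarrow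 C(j))$; the connectives are interpreted by the operations of $\mathbb B$; and $[\![\exists x<t\,\varphi(x)]\!]=\bigvee_{x<\hat t}([\![x<t]\!]\wedge[\![\varphi(x)]\!])$, $[\![\forall x<t\,\varphi(x)]\!]=\bigwedge_{x<\hat t}(\neg[\![x<t]\!]\vee[\![\varphi(x)]\!])$, where $\hat t$ is the value of $t$ when each $|A_i|$ is replaced by $a_i$ (and $x<t$ is treated as an atomic formula). $\mathbb B$ *admits a $\Sigma^B_0$-translation* if for every $\Sigma^B_0$ formula $\varphi(x)$ with such parameters and every $a\in M_0$ all values $[\![\varphi(i)]\!]$, $i<a$, exist and the function $i\mapsto[\![\varphi(i)]\!]$ $(i<a)$ belongs to $M^{\mathbb B}$, and every $A:a\to\mathbb B$ in $M^{\mathbb B}$ has a length in the Boolean sense, $\bigvee_{\ell\le a}[\![|A|=\ell]\!]=1$. **Genericity.** A proper ideal $I\subseteq\mathbb B$ is $M_0$-complete if for every $A:a\to\mathbb B$ in $M^{\mathbb B}$ with $A(i)\in I$ for all $i<a$, also $\bigvee_{i<a}A(i)\in I$ (whenever this join exists). $D\subseteq\mathbb B$ is dense over $I$ if below every element of $\mathbb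 B\setminus I$ there is an element of $D\setminus I$; it is definable if the class of strings representing elements of $D$ is definable. A proper filter $G\subseteq\mathbb B$ is $\mathcal M$-generic over $I$ if $(D\setminus I)\cap G\ne\emptyset$ for each definable $D$ dense over $I$. For $A:a\to\mathbb B$ in $M^{\mathbb B}$ let $i_G(A)=\{y<a:A(y)\in G\}$, and let $M[G]=\{i_G(A):A\in M^{\mathbb B}\}$. $(M_0,M[G])$ is the two-sorted structure with the number part of $\mathcal M$, with membership as $X(y)$, and with $|S|$ equal to one more than the largest element of $S$ ($|\emptyset|=0$; also $|S|=0$, as a convention, if $S$ has no largest element, in which case a length axiom of $V^0$ fails). **Theorem.** Let $\mathbb B$ be a Boolean algebra in $M$ that admits a $\Sigma^B_0$-translation, let $I\subseteq\mathbb B$ be an $M_0$-complete ideal, and let $G\subseteq\mathbb B$ be $\mathcal M$-generic over $I$. Then $$(M_0,M[G])\models V^0 .$$ -/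

import Mathlib

universe u v w

/-! Two-sorted language of bounded arithmetic: number terms and formulas.
Number variables and string variables are both indexed by natural numbers. -/

/-- Number terms over `0, s, +, ·, |X|`. -/
inductive NTerm : Type
  | var (x : ℕ)
  | zero
  | succ (t : NTerm)
  | add (t s : NTerm)
  | mul (t s : NTerm)
  | len (X : ℕ)

/-- Formulas of the two-sorted language. `exB x t φ` and `allB x t φ` are the bounded number
quantifiers `∃ x < t, φ` and `∀ x < t, φ`, where an occurrence of `x` in `t` is not bound. -/
inductive Fml : Type
  | le (t s : NTerm)
  | eqN (t s : NTerm)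
  | eqS (X Y : ℕ)
  | mem (t : NTerm) (X : ℕ)
  | not (φ : Fml)
  | and (φ ψ : Fml)
  | or (φ ψ : Fml)
  | exB (x : ℕ) (t : NTerm) (φ : Fml)
  | allB (x : ℕ) (t : NTerm) (φ : Fml)
  | exN (x : ℕ) (φ : Fml)
  | allN (x : ℕ) (φ : Fml)
  | exS (X : ℕ) (φ : Fml)
  | allS (X : ℕ) (φ : Fml)

/-- `Σᴮ₀` formulas: all quantifiers are bounded number quantifiers. -/
def Fml.IsSigmaB0 : Fml → Prop
  | .le _ _ => True
  | .eqN _ _ => True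
  | .eqS _ _ => True
  | .mem _ _ => True
  | .not φ => φ.IsSigmaB0
  | .and φ ψ => φ.IsSigmaB0 ∧ ψ.IsSigmaB0
  | .or φ ψ => φ.IsSigmaB0 ∧ ψ.IsSigmaB0
  | .exB _ _ φ => φ.IsSigmaB0
  | .allB _ _ φ => φ.IsSigmaB0
  | .exN _ _ => False
  | .allN _ _ => False
  | .exS _ _ => False
  | .allS _ _ => False

/-- The string variables `X` whose length `|X|` occurs in a term. -/
def NTerm.lenVars : NTerm → Finset ℕ
  | .var _ => ∅
  | .zero => ∅
  | .succ t => t.lenVars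
  | .add t s => t.lenVars ∪ s.lenVars
  | .mul t s => t.lenVars ∪ s.lenVars
  | .len X => {X}

/-- Two-sorted structures `(M₀, M)`: numbers, strings, and the basic symbols. -/
structure TwoSorted where
  Num : Type u
  Str : Type v
  zero : Num
  succ : Num → Num
  add : Num → Num → Num
  mul : Num → Num → Num
  len : Str → Num
  le : Num → Num → Prop
  mem : Num → Str → Prop

namespace TwoSorted

variable (𝓜 : TwoSorted.{u, v})

def lt (x y : 𝓜.Num) : Prop := 𝓜.le x y ∧ x ≠ y

def one : 𝓜.Num := 𝓜.succ 𝓜.zero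

def two : 𝓜.Num := 𝓜.succ 𝓜.one

/-- The pairing function `⟨x, y⟩ = (x + y)(x + y + 1) + 2 y`. -/
def pair (x y : 𝓜.Num) : 𝓜.Num :=
  𝓜.add (𝓜.mul (𝓜.add x y) (𝓜.succ (𝓜.add x y))) (𝓜.add y y)

/-- Value of a term, given the values `ν` of the number variables and the values `l` of the
lengths of the string variables. -/
def termVal (ν l : ℕ → 𝓜.Num) : NTerm → 𝓜.Num
  | .var x => ν x
  | .zero => 𝓜.zero
  | .succ t => 𝓜.succ (termVal ν l t)
  | .add t s => 𝓜.add (termVal ν l t) (termVal ν l s)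
  | .mul t s => 𝓜.mul (termVal ν l t) (termVal ν l s)
  | .len X => l X

/-- Tarskian satisfaction. -/
def Sat : Fml → (ℕ → 𝓜.Num) → (ℕ → 𝓜.Str) → Prop
  | .le t s, ν, σ =>
      𝓜.le (𝓜.termVal ν (fun X => 𝓜.len (σ X)) t) (𝓜.termVal ν (fun X => 𝓜.len (σ X)) s)
  | .eqN t s, ν, σ =>
      𝓜.termVal ν (fun X => 𝓜.len (σ X)) t = 𝓜.termVal ν (fun X => 𝓜.len (σ X)) s
  | .eqS X Y, _, σ => σ X = σ Y
  | .mem t X, ν, σ => 𝓜.mem (𝓜.termVal ν (fun X => 𝓜.len (σ X)) t) (σ X)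
  | .not φ, ν, σ => ¬ Sat φ ν σ
  | .and φ ψ, ν, σ => Sat φ ν σ ∧ Sat ψ ν σ
  | .or φ ψ, ν, σ => Sat φ ν σ ∨ Sat ψ ν σ
  | .exB x t φ, ν, σ =>
      ∃ a, 𝓜.lt a (𝓜.termVal ν (fun X => 𝓜.len (σ X)) t) ∧ Sat φ (Function.update ν x a) σ
  | .allB x t φ, ν, σ =>
      ∀ a, 𝓜.lt a (𝓜.termVal ν (fun X => 𝓜.len (σ X)) t) → Sat φ (Function.update ν x a) σ
  | .exN x φ, ν, σ => ∃ a, Sat φ (Function.update ν x a) σ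
  | .allN x φ, ν, σ => ∀ a, Sat φ (Function.update ν x a) σ
  | .exS X φ, ν, σ => ∃ A, Sat φ ν (Function.update σ X A)
  | .allS X φ, ν, σ => ∀ A, Sat φ ν (Function.update σ X A)

/-- The theory 2-BASIC. -/
structure IsBasic : Prop where
  b1 : ∀ x, 𝓜.succ x ≠ 𝓜.zero
  b2 : ∀ x y, 𝓜.succ x = 𝓜.succ y → x = y
  b3 : ∀ x, 𝓜.add x 𝓜.zero = x
  b4 : ∀ x y, 𝓜.add x (𝓜.succ y) = 𝓜.succ (𝓜.add x y)
  b5 : ∀ x, 𝓜.mul x 𝓜.zero = 𝓜.zero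
  b6 : ∀ x y, 𝓜.mul x (𝓜.succ y) = 𝓜.add (𝓜.mul x y) x
  b7 : ∀ x y, 𝓜.le x y → 𝓜.le y x → x = y
  b8 : ∀ x y, 𝓜.le x (𝓜.add x y)
  b9 : ∀ x, 𝓜.le 𝓜.zero x
  b10 : ∀ x y, 𝓜.le x y ∨ 𝓜.le y x
  b11 : ∀ x y, 𝓜.le x y ↔ 𝓜.lt x (𝓜.succ y)
  b12 : ∀ x, x ≠ 𝓜.zero → ∃ y, 𝓜.le y x ∧ 𝓜.succ y = x
  l1 : ∀ y X, 𝓜.mem y X → 𝓜.lt y (𝓜.len X)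
  l2 : ∀ y X, 𝓜.succ y = 𝓜.len X → 𝓜.mem y X
  se : ∀ X Y, 𝓜.len X = 𝓜.len Y →
    (∀ i, 𝓜.lt i (𝓜.len X) → (𝓜.mem i X ↔ 𝓜.mem i Y)) → X = Y

/-- `𝓜 ⊨ V⁰`, where `V⁰` is 2-BASIC together with `Σᴮ₀`-comprehension. -/
structure ModelsV0 : Prop where
  basic : 𝓜.IsBasic
  comp : ∀ φ : Fml, φ.IsSigmaB0 → ∀ (x : ℕ) (ν : ℕ → 𝓜.Num) (σ : ℕ → 𝓜.Str) (a : 𝓜.Num),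
    ∃ Y, 𝓜.le (𝓜.len Y) a ∧
      ∀ z, 𝓜.lt z a → (𝓜.mem z Y ↔ 𝓜.Sat φ (Function.update ν x z) σ)

/-- The monotone circuit value axiom. -/
def MCV : Prop :=
  ∀ (a : 𝓜.Num) (C E : 𝓜.Str), ∃ Y : 𝓜.Str,
    ¬ 𝓜.mem 𝓜.zero Y ∧ 𝓜.mem 𝓜.one Y ∧
    ∀ x, 𝓜.lt x a → 𝓜.le 𝓜.two x →
      (𝓜.mem x Y ↔
        (𝓜.mem x C ∧ ∀ y, 𝓜.lt y x → 𝓜.mem (𝓜.pair y x) E → 𝓜.mem y Y) ∨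
        (¬ 𝓜.mem x C ∧ ∃ y, 𝓜.lt y x ∧ 𝓜.mem (𝓜.pair y x) E ∧ 𝓜.mem y Y))

/-- `𝓜 ⊨ VP`, where `VP = V⁰ + MCV`. -/
def ModelsVP : Prop := 𝓜.ModelsV0 ∧ 𝓜.MCV

/-- `y = 2 ^ a`, witnessed by a string coding pairs `⟨i, 2 ^ i⟩`. -/
def IsPowTwo (a y : 𝓜.Num) : Prop :=
  ∃ S : 𝓜.Str, 𝓜.mem (𝓜.pair a y) S ∧
    (∀ z, 𝓜.mem (𝓜.pair 𝓜.zero z) S → z = 𝓜.one) ∧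
    ∀ i z, 𝓜.mem (𝓜.pair (𝓜.succ i) z) S → ∃ y', z = 𝓜.add y' y' ∧ 𝓜.mem (𝓜.pair i y') S

/-- The axiom `Exp`: exponentiation is total on numbers. -/
def Exp : Prop := ∀ a, ∃ y, 𝓜.IsPowTwo a y

/-- Some number is not a numeral. -/
def IsNonstandard : Prop := ∃ a : 𝓜.Num, ∀ n : ℕ, a ≠ 𝓜.succ^[n] 𝓜.zero

/-- Ground models: countable nonstandard models of `VP + ¬Exp`. -/
structure IsGround : Prop where
  countable_num : Countable 𝓜.Num
  countable_str : Countable 𝓜.Str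
  nonstandard : 𝓜.IsNonstandard
  vp : 𝓜.ModelsVP
  not_exp : ¬ 𝓜.Exp

/-- A class of strings that is definable with parameters (the free variable is the string
variable `0`). -/
def DefinableStr (S : 𝓜.Str → Prop) : Prop :=
  ∃ (φ : Fml) (ν : ℕ → 𝓜.Num) (σ : ℕ → 𝓜.Str),
    ∀ X, S X ↔ 𝓜.Sat φ ν (Function.update σ 0 X)

/-- A binary relation on strings that is definable with parameters (the free variables are the
string variables `0` and `1`). -/
def DefinableStr₂ (R : 𝓜.Str → 𝓜.Str → Prop) : Prop :=
  ∃ (φ : Fml) (ν : ℕ → 𝓜.Num) (σ : ℕ → 𝓜.Str),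
    ∀ X Y, R X Y ↔ 𝓜.Sat φ ν (Function.update (Function.update σ 0 X) 1 Y)

/-- `Z` is the `i`-th row of the two-dimensional array coded by `X`. -/
def IsRow (X : 𝓜.Str) (i : 𝓜.Num) (Z : 𝓜.Str) : Prop :=
  ∀ j, 𝓜.mem j Z ↔ 𝓜.mem (𝓜.pair i j) X

end TwoSorted

/-- A presentation of the Boolean algebra `B` inside `𝓜`: the elements of `B` are the classes of
strings from a definable class `carrier`, and the order of `B` is definable on representatives. -/
structure InternalBA (𝓜 : TwoSorted.{u, v}) (B : Type w) [BooleanAlgebra B] where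
  carrier : 𝓜.Str → Prop
  val : 𝓜.Str → B
  surj : ∀ b : B, ∃ X, carrier X ∧ val X = b
  carrier_definable : 𝓜.DefinableStr carrier
  le_definable : 𝓜.DefinableStr₂ fun X Y => carrier X ∧ carrier Y ∧ val X ≤ val Y

namespace InternalBA

variable {𝓜 : TwoSorted.{u, v}} {B : Type w} [BooleanAlgebra B] (P : InternalBA 𝓜 B)

/-- The elements of `M^𝔹`: functions `{i : i < dom} → 𝔹` that are coded by a string of `M`, whose
`i`-th row represents the `i`-th value. They are continued by `0` outside of their domain. -/
structure Name where
  dom : 𝓜.Num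
  toFun : 𝓜.Num → B
  coded : ∃ X : 𝓜.Str, ∀ i, 𝓜.lt i dom → ∃ Z, 𝓜.IsRow X i Z ∧ P.carrier Z ∧ P.val Z = toFun i
  outside : ∀ i, ¬ 𝓜.lt i dom → toFun i = ⊥

variable {P}

/-- The conditions whose meet is the Boolean value of `|A| = l`: the bit `l - 1` of `A` is set
(if `l ≠ 0`), and no bit from `l` on is set. -/
def lenConds (A : P.Name) (l : 𝓜.Num) : Set B :=
  {c | ∃ k, 𝓜.succ k = l ∧ c = A.toFun k} ∪
    {c | ∃ j, 𝓜.le l j ∧ 𝓜.lt j A.dom ∧ c = (A.toFun j)ᶜ}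

/-- `b` is the Boolean value of an atomic formula that mentions the lengths of the strings `σ X`,
`X ∈ vs`, and that has the value `α l` if `|σ X| = l X` for `X ∈ vs`; that is,
`b = ⋁_l (⋀_{X ∈ vs} ⟦|σ X| = l X⟧ ∧ α l)`. For `vs = ∅` this is just the value of `α`. -/
def IsLenValue (vs : Finset ℕ) (σ : ℕ → P.Name) (α : (ℕ → 𝓜.Num) → B) (b : B) : Prop :=
  ∃ W : (ℕ → 𝓜.Num) → B,
    (∀ l, IsGLB {c | ∃ X ∈ vs, c ∈ lenConds (σ X) (l X)} (W l)) ∧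
    IsLUB {c | ∃ l : ℕ → 𝓜.Num, (∀ X ∈ vs, 𝓜.le (l X) (σ X).dom) ∧ c = W l ⊓ α l} b

open Classical in
/-- The truth value in `B` of a proposition. -/
noncomputable def truth (B : Type w) [BooleanAlgebra B] (p : Prop) : B := if p then ⊤ else ⊥

/-- `IsValue φ ν σ b` says that the propositional translation of the `Σᴮ₀` formula `φ`, with the
number parameters `ν` and with the elements `σ` of `M^𝔹` substituted for the propositional
variables, can be evaluated in `𝔹`, and that its value `⟦φ⟧` is `b`. Bounded quantifiers are
translated by joins and meets in `𝔹`; the range of `∃ x < t` is bounded by the value of `t` at the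
largest possible lengths, and `⟦a < t⟧` takes care of the actual lengths. -/
def IsValue : Fml → (ℕ → 𝓜.Num) → (ℕ → P.Name) → B → Prop
  | .le t s, ν, σ, b =>
      IsLenValue (t.lenVars ∪ s.lenVars) σ
        (fun l => truth B (𝓜.le (𝓜.termVal ν l t) (𝓜.termVal ν l s))) b
  | .eqN t s, ν, σ, b =>
      IsLenValue (t.lenVars ∪ s.lenVars) σ
        (fun l => truth B (𝓜.termVal ν l t = 𝓜.termVal ν l s)) b
  | .eqS X Y, _, σ, b =>
      IsGLB {c | ∃ j, (𝓜.lt j (σ X).dom ∨ 𝓜.lt j (σ Y).dom) ∧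
        c = ((σ X).toFun j ⊓ (σ Y).toFun j) ⊔ (((σ X).toFun j)ᶜ ⊓ ((σ Y).toFun j)ᶜ)} b
  | .mem t X, ν, σ, b =>
      IsLenValue t.lenVars σ (fun l => (σ X).toFun (𝓜.termVal ν l t)) b
  | .not φ, ν, σ, b => ∃ c, IsValue φ ν σ c ∧ b = cᶜ
  | .and φ ψ, ν, σ, b => ∃ c d, IsValue φ ν σ c ∧ IsValue ψ ν σ d ∧ b = c ⊓ d
  | .or φ ψ, ν, σ, b => ∃ c d, IsValue φ ν σ c ∧ IsValue ψ ν σ d ∧ b = c ⊔ d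
  | .exB x t φ, ν, σ, b =>
      ∃ f g : 𝓜.Num → B,
        (∀ a, 𝓜.lt a (𝓜.termVal ν (fun X => (σ X).dom) t) →
          IsLenValue t.lenVars σ (fun l => truth B (𝓜.lt a (𝓜.termVal ν l t))) (f a) ∧
          IsValue φ (Function.update ν x a) σ (g a)) ∧
        IsLUB {c | ∃ a, 𝓜.lt a (𝓜.termVal ν (fun X => (σ X).dom) t) ∧ c = f a ⊓ g a} b
  | .allB x t φ, ν, σ, b =>
      ∃ f g : 𝓜.Num → B,
        (∀ a, 𝓜.lt a (𝓜.termVal ν (fun X => (σ X).dom) t) →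
          IsLenValue t.lenVars σ (fun l => truth B (𝓜.lt a (𝓜.termVal ν l t))) (f a) ∧
          IsValue φ (Function.update ν x a) σ (g a)) ∧
        IsGLB {c | ∃ a, 𝓜.lt a (𝓜.termVal ν (fun X => (σ X).dom) t) ∧ c = (f a)ᶜ ⊔ g a} b
  | .exN _ _, _, _, _ => False
  | .allN _ _, _, _, _ => False
  | .exS _ _, _, _, _ => False
  | .allS _ _, _, _, _ => False

variable (P)

/-- `𝔹` admits a `Σᴮ₀`-translation: every `Σᴮ₀` formula with parameters from `M₀` and `M^𝔹` has a
value in `𝔹`, and the values for the instances `φ(i)`, `i < a`, form an element of `M^𝔹`;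
moreover the symbol `|X|` can be translated, i.e. every element of `M^𝔹` has a length with
Boolean value `1`. -/
structure AdmitsSigmaB0Translation : Prop where
  value : ∀ φ : Fml, φ.IsSigmaB0 → ∀ (x : ℕ) (ν : ℕ → 𝓜.Num) (σ : ℕ → P.Name) (a : 𝓜.Num),
    ∃ F : P.Name, F.dom = a ∧
      ∀ i, 𝓜.lt i a → IsValue φ (Function.update ν x i) σ (F.toFun i)
  length : ∀ A : P.Name,
    IsLUB {c | ∃ l, 𝓜.le l A.dom ∧ IsGLB (lenConds A l) c} (⊤ : B)

/-- `I` is a (proper) `M₀`-complete ideal. -/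
structure IsM0Complete (I : Order.Ideal B) : Prop where
  proper : (⊤ : B) ∉ I
  complete : ∀ (A : P.Name), (∀ i, 𝓜.lt i A.dom → A.toFun i ∈ I) →
    ∀ b, IsLUB {c | ∃ i, 𝓜.lt i A.dom ∧ c = A.toFun i} b → b ∈ I

/-- `D ⊆ 𝔹` is definable in `𝓜` with parameters. -/
def IsDefinable (D : Set B) : Prop :=
  𝓜.DefinableStr fun X => P.carrier X ∧ P.val X ∈ D

/-- `D ⊆ 𝔹` is dense over `I`. -/
def IsDenseOver (I : Order.Ideal B) (D : Set B) : Prop :=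
  ∀ b, b ∉ I → ∃ c ∈ D, c ∉ I ∧ c ≤ b

/-- `G` is an `𝓜`-generic (proper) filter over `I`. -/
structure IsGeneric (I : Order.Ideal B) (G : Order.PFilter B) : Prop where
  proper : (⊥ : B) ∉ G
  meets : ∀ D : Set B, P.IsDefinable D → IsDenseOver I D → ∃ c ∈ D, c ∉ I ∧ c ∈ G

variable {P} in
/-- `i_G(A) = {y < a : A(y) ∈ G}` for `A : a → 𝔹`. -/
def interp (G : Order.PFilter B) (A : P.Name) : Set 𝓜.Num :=
  {y | 𝓜.lt y A.dom ∧ A.toFun y ∈ G}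

/-- `M[G] = {i_G(A) : A ∈ M^𝔹}`. -/
def genericStr (G : Order.PFilter B) : Set (Set 𝓜.Num) := Set.range (interp (P := P) G)

open Classical in
/-- The length of a set of numbers: one more than its largest element, `0` for the empty set (and
for a set without largest element, for which the axiom `X(y) → y < |X|` then fails). -/
noncomputable def setLen (𝓜 : TwoSorted.{u, v}) (S : Set 𝓜.Num) : 𝓜.Num :=
  if h : ∃ m, m ∈ S ∧ ∀ y ∈ S, 𝓜.le y m then 𝓜.succ h.choose else 𝓜.zero

/-- The generic model `(M₀, M[G])`. -/
noncomputable def genericModel (G : Order.PFilter B) : TwoSorted.{u, u} where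
  Num := 𝓜.Num
  Str := P.genericStr G
  zero := 𝓜.zero
  succ := 𝓜.succ
  add := 𝓜.add
  mul := 𝓜.mul
  len S := setLen 𝓜 S.1
  le := 𝓜.le
  mem y S := y ∈ S.1

end InternalBA

/-! The heart is a truth lemma (`mem_iff_sat`): a `Σᴮ₀` formula holds in `(M₀, M[G])` iff its
Boolean value lies in `G`. Comprehension follows: admissibility makes `i ↦ ⟦φ(i)⟧`, `i < a`, an
element `F` of `M^𝔹`, and `i_G(F)` is exactly the required set.

The truth lemma needs `G` to respect joins of coded families, which is where genericity enters
(`compl_mem_or`). If `b = ⋁ A(i)`, the elements below `¬b` or below some `A(i)` form a definable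
set. It is dense over `I`: if no element of it outside `I` lay below `c`, then `c ∧ ¬b` and all `c ∧
A(i)` would be in `I`, so `c ∧ b ∈ I` by `M₀`-completeness, and `c ∈ I`. Hence `G` contains `¬b` or
some `A(i)`. One-entry families show that `G` is an ultrafilter.

The family `⟦|A| = ℓ⟧` has join `1`, so `G` selects one `ℓ`, and this is the true length of `i_G(A)`
(`exists_len`). This gives the length axioms. It also reduces atomic formulas and quantifier bounds
to actual lengths, since a finite meet `τ ∈ G` of such values fixes all lengths involved.

The arithmetic developed in `V⁰` serves three ends: transitivity of `≤`, monotonicity of terms in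
the lengths, and coding a single string as a row of an array. -/

namespace TwoSorted

variable {𝓜 : TwoSorted.{u, v}}

/-! ### Order and arithmetic in models of `V⁰` -/

namespace IsBasic

variable (h : 𝓜.IsBasic)
include h

theorem le_refl (x : 𝓜.Num) : 𝓜.le x x := (h.b10 x x).elim id id

theorem lt_succ_self (x : 𝓜.Num) : 𝓜.lt x (𝓜.succ x) := (h.b11 x x).1 (h.le_refl x)

theorem le_zero {x : 𝓜.Num} (hx : 𝓜.le x 𝓜.zero) : x = 𝓜.zero := h.b7 _ _ hx (h.b9 x)

theorem not_lt_zero (x : 𝓜.Num) : ¬ 𝓜.lt x 𝓜.zero := fun hx => hx.2 (h.le_zero hx.1)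

theorem not_lt {x y : 𝓜.Num} : ¬ 𝓜.lt x y ↔ 𝓜.le y x := by
  constructor
  · intro hxy
    rcases h.b10 x y with hle | hle
    · by_cases he : x = y
      · exact he ▸ h.le_refl x
      · exact (hxy ⟨hle, he⟩).elim
    · exact hle
  · exact fun hyx hxy => hxy.2 (h.b7 _ _ hxy.1 hyx)

theorem not_le {x y : 𝓜.Num} : ¬ 𝓜.le x y ↔ 𝓜.lt y x := by
  rw [← h.not_lt, not_not]

theorem succ_le_of_lt {x y : 𝓜.Num} (hxy : 𝓜.lt x y) : 𝓜.le (𝓜.succ x) y := by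
  rw [← h.not_lt, ← h.b11]
  exact fun hyx => hxy.2 (h.b7 _ _ hxy.1 hyx)

theorem len_le_len {X Y : 𝓜.Str} (hXY : ∀ i, 𝓜.mem i X → 𝓜.mem i Y) :
    𝓜.le (𝓜.len X) (𝓜.len Y) := by
  by_cases h0 : 𝓜.len X = 𝓜.zero
  · exact h0 ▸ h.b9 _
  · obtain ⟨y, -, hy⟩ := h.b12 _ h0
    exact hy ▸ h.succ_le_of_lt (h.l1 _ _ (hXY _ (h.l2 _ _ hy)))

theorem str_ext {X Y : 𝓜.Str} (hXY : ∀ i, 𝓜.mem i X ↔ 𝓜.mem i Y) : X = Y :=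
  h.se _ _ (h.b7 _ _ (h.len_le_len fun i => (hXY i).1) (h.len_le_len fun i => (hXY i).2))
    fun i _ => hXY i

end IsBasic

/-! ### Least elements and induction from comprehension -/

namespace ModelsV0

variable (h : 𝓜.ModelsV0)
include h

theorem exists_min {X : 𝓜.Str} (hX : 𝓜.len X ≠ 𝓜.zero) :
    ∃ x, 𝓜.mem x X ∧ ∀ y, 𝓜.lt y x → ¬ 𝓜.mem y X := by
  have hb := h.basic
  -- `Y` is the set of `z < |X|` such that no `y ≤ z` is in `X`; its length is the least element of
  -- `X`.
  obtain ⟨Y, hYle, hY⟩ := h.comp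
    (.allB 1 (.succ (.var 0)) (.not (.mem (.var 1) 0))) trivial 0 (fun _ => 𝓜.zero) (fun _ => X)
    (𝓜.len X)
  simp only [Sat, termVal, ← hb.b11, Function.update_self] at hY
  have hlt : 𝓜.lt (𝓜.len Y) (𝓜.len X) := by
    refine ⟨hYle, fun he => ?_⟩
    obtain ⟨z, -, hz⟩ := hb.b12 _ hX
    have hzX := hb.l2 _ _ hz
    exact (hY z (hb.l1 _ _ hzX)).1 (hb.l2 _ _ (hz.trans he.symm)) z (hb.le_refl z) hzX
  have hnot : ¬ 𝓜.mem (𝓜.len Y) Y := fun hm => (hb.l1 _ _ hm).2 rfl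
  rw [hY _ hlt] at hnot
  push Not at hnot
  obtain ⟨i, hi, hiX⟩ := hnot
  have hbelow : ∀ y, 𝓜.lt y (𝓜.len Y) → ¬ 𝓜.mem y X := by
    intro y hy
    have h0 : 𝓜.len Y ≠ 𝓜.zero := fun h0 => hb.not_lt_zero y (h0 ▸ hy)
    obtain ⟨z, hzle, hz⟩ := hb.b12 _ h0
    have hzY := hb.l2 _ _ hz
    have hzX : 𝓜.lt z (𝓜.len X) := by
      have hzlt := hb.l1 _ _ hzY
      by_contra hc
      have := hb.succ_le_of_lt hlt
      rw [hb.not_lt] at hc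
      have h1 : 𝓜.lt (𝓜.len X) (𝓜.succ z) := (hb.b11 _ _).1 hc
      rw [hz] at h1
      exact h1.2 (hb.b7 _ _ h1.1 hYle)
    exact (hY z hzX).1 hzY y ((hb.b11 _ _).2 (hz ▸ hy))
  have : i = 𝓜.len Y := by
    by_contra hne
    exact hbelow i ⟨hi, hne⟩ hiX
  exact ⟨_, this ▸ hiX, hbelow⟩

/-- Induction for `Σᴮ₀` formulas. -/
theorem induction {φ : Fml} (hφ : φ.IsSigmaB0) (x : ℕ) (ν : ℕ → 𝓜.Num) (σ : ℕ → 𝓜.Str)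
    (h0 : 𝓜.Sat φ (Function.update ν x 𝓜.zero) σ)
    (hs : ∀ n, 𝓜.Sat φ (Function.update ν x n) σ → 𝓜.Sat φ (Function.update ν x (𝓜.succ n)) σ)
    (a : 𝓜.Num) : 𝓜.Sat φ (Function.update ν x a) σ := by
  have hb := h.basic
  by_contra ha
  -- The counterexamples up to and including `a`; the least one is a successor whose predecessor
  -- satisfies `φ`.
  obtain ⟨X, -, hX⟩ := h.comp (.not φ) hφ x ν σ (𝓜.succ a)
  simp only [Sat, ← hb.b11] at hX
  have haX : 𝓜.mem a X := (hX a (hb.le_refl a)).2 ha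
  obtain ⟨m, hm, hmin⟩ := h.exists_min
    (fun h0 => hb.not_lt_zero a (h0 ▸ hb.l1 _ _ haX) : 𝓜.len X ≠ 𝓜.zero)
  have hm0 : m ≠ 𝓜.zero := by
    rintro rfl
    exact (hX _ (hb.b9 a)).1 hm h0
  obtain ⟨y, -, rfl⟩ := hb.b12 m hm0
  have hma : 𝓜.le (𝓜.succ y) a := by
    rw [← hb.not_lt]
    exact fun hlt => hmin a hlt haX
  have hya : 𝓜.le y a := by
    rw [← hb.not_lt]
    exact fun hlt => hmin a ((hb.b11 _ _).1 hlt.1) haX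
  have hy := hmin y (hb.lt_succ_self y)
  rw [hX y hya, not_not] at hy
  exact (hX _ hma).1 hm (hs y hy)

/-! ### Arithmetic by induction (some string is needed to fill the string assignment) -/

section Arithmetic

variable [Nonempty 𝓜.Str]

/-- The assignment `l` of lengths is irrelevant for terms without `len`; quantifying it this way
lets it be simplified away. -/
theorem eq_induction (t s : NTerm) (ν : ℕ → 𝓜.Num)
    (h0 : ∀ l, 𝓜.termVal (Function.update ν 0 𝓜.zero) l t =
      𝓜.termVal (Function.update ν 0 𝓜.zero) l s)
    (hs : ∀ n l, 𝓜.termVal (Function.update ν 0 n) l t = 𝓜.termVal (Function.update ν 0 n) l s →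
      𝓜.termVal (Function.update ν 0 (𝓜.succ n)) l t =
        𝓜.termVal (Function.update ν 0 (𝓜.succ n)) l s) (a : 𝓜.Num) :
    ∃ l, 𝓜.termVal (Function.update ν 0 a) l t = 𝓜.termVal (Function.update ν 0 a) l s :=
  ⟨_, h.induction (φ := .eqN t s) trivial 0 ν (fun _ => Classical.arbitrary _) (h0 _)
    (fun n => hs n _) a⟩

theorem zero_add (x : 𝓜.Num) : 𝓜.add 𝓜.zero x = x := by
  have := h.eq_induction (.add .zero (.var 0)) (.var 0) (fun _ => 𝓜.zero)
  simp only [termVal, Function.update_self, exists_const_iff] at this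
  refine (this (fun _ => h.basic.b3 _) (fun n _ hn => by rw [h.basic.b4, hn]) x).2

theorem succ_add (x y : 𝓜.Num) : 𝓜.add (𝓜.succ x) y = 𝓜.succ (𝓜.add x y) := by
  have := h.eq_induction (.add (.succ (.var 1)) (.var 0)) (.succ (.add (.var 1) (.var 0)))
    (fun _ => x)
  simp only [termVal, Function.update_self, exists_const_iff, ne_eq, one_ne_zero,
    not_false_eq_true, Function.update_of_ne] at this
  exact (this (fun _ => by simp only [h.basic.b3])
    (fun n _ hn => by rw [h.basic.b4, h.basic.b4, hn]) y).2

theorem add_comm (x y : 𝓜.Num) : 𝓜.add x y = 𝓜.add y x := by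
  have := h.eq_induction (.add (.var 1) (.var 0)) (.add (.var 0) (.var 1)) (fun _ => x)
  simp only [termVal, Function.update_self, exists_const_iff, ne_eq, one_ne_zero,
    not_false_eq_true, Function.update_of_ne] at this
  exact (this (fun _ => by rw [h.basic.b3, h.zero_add])
    (fun n _ hn => by rw [h.basic.b4, h.succ_add, hn]) y).2

theorem add_assoc (x y z : 𝓜.Num) : 𝓜.add (𝓜.add x y) z = 𝓜.add x (𝓜.add y z) := by
  have := h.eq_induction (.add (.add (.var 1) (.var 2)) (.var 0))
    (.add (.var 1) (.add (.var 2) (.var 0))) (fun n => if n = 1 then x else y)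
  simp only [termVal, Function.update_self, exists_const_iff, ne_eq, one_ne_zero,
    not_false_eq_true, Function.update_of_ne, OfNat.ofNat_ne_zero, OfNat.ofNat_ne_one, if_true,
    if_false] at this
  exact (this (fun _ => by simp only [h.basic.b3])
    (fun n _ hn => by simp only [h.basic.b4, hn]) z).2

theorem add_left_cancel {x y z : 𝓜.Num} (hxyz : 𝓜.add x y = 𝓜.add x z) : y = z := by
  have := h.induction (φ := .or (.not (.eqN (.add (.var 0) (.var 1)) (.add (.var 0) (.var 2))))
    (.eqN (.var 1) (.var 2))) ⟨trivial, trivial⟩ 0 (fun n => if n = 1 then y else z)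
    (fun _ => Classical.arbitrary _)
  simp only [Sat, termVal, Function.update_self, ne_eq, one_ne_zero,
    not_false_eq_true, Function.update_of_ne, OfNat.ofNat_ne_zero, OfNat.ofNat_ne_one, if_true,
    if_false, ← imp_iff_not_or] at this
  refine this ?_ ?_ x hxyz
  · simp only [h.zero_add, imp_self]
  · intro n hn hn'
    rw [h.succ_add, h.succ_add] at hn'
    exact hn (h.basic.b2 _ _ hn')

theorem exists_add_of_le {x y : 𝓜.Num} (hxy : 𝓜.le x y) : ∃ z, y = 𝓜.add x z := by
  have hb := h.basic
  -- Induction on `y`; the bound `z < y + 1` on the difference keeps the formula `Σᴮ₀`.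
  have := h.induction (φ := .or (.not (.le (.var 1) (.var 0)))
    (.exB 2 (.succ (.var 0)) (.eqN (.var 0) (.add (.var 1) (.var 2))))) ⟨trivial, trivial⟩ 0
    (fun _ => x) (fun _ => Classical.arbitrary _)
  simp only [Sat, termVal, Function.update_self, ne_eq, one_ne_zero,
    not_false_eq_true, Function.update_of_ne,
    OfNat.zero_ne_ofNat, OfNat.one_ne_ofNat, ← imp_iff_not_or] at this
  refine (this ?_ ?_ y hxy).imp fun z hz => hz.2
  · intro hx
    exact ⟨𝓜.zero, hb.lt_succ_self _, by rw [hb.le_zero hx, hb.b3]⟩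
  · intro n hn hx
    by_cases he : x = 𝓜.succ n
    · exact ⟨𝓜.zero, (hb.b11 _ _).1 (hb.b9 _), by rw [hb.b3, he]⟩
    · obtain ⟨z, -, hz⟩ := hn ((hb.b11 _ _).2 ⟨hx, he⟩)
      have he : 𝓜.succ n = 𝓜.add x (𝓜.succ z) := by rw [hb.b4, ← hz]
      exact ⟨𝓜.succ z, (hb.b11 _ _).1 (by rw [he, h.add_comm]; exact hb.b8 _ _), he⟩

theorem le_trans {x y z : 𝓜.Num} (hxy : 𝓜.le x y) (hyz : 𝓜.le y z) : 𝓜.le x z := by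
  obtain ⟨a, rfl⟩ := h.exists_add_of_le hxy
  obtain ⟨b, rfl⟩ := h.exists_add_of_le hyz
  rw [h.add_assoc]
  exact h.basic.b8 _ _

theorem lt_of_lt_of_le {x y z : 𝓜.Num} (hxy : 𝓜.lt x y) (hyz : 𝓜.le y z) : 𝓜.lt x z := by
  rw [← h.basic.not_le]
  exact fun hzx => h.basic.not_le.2 hxy (h.le_trans hyz hzx)

theorem add_add_add_comm (a b c d : 𝓜.Num) :
    𝓜.add (𝓜.add a b) (𝓜.add c d) = 𝓜.add (𝓜.add a c) (𝓜.add b d) := by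
  rw [h.add_assoc, h.add_assoc, ← h.add_assoc b, h.add_comm b c, h.add_assoc c]

theorem add_le_add {a b c d : 𝓜.Num} (hab : 𝓜.le a b) (hcd : 𝓜.le c d) :
    𝓜.le (𝓜.add a c) (𝓜.add b d) := by
  obtain ⟨e, rfl⟩ := h.exists_add_of_le hab
  obtain ⟨f, rfl⟩ := h.exists_add_of_le hcd
  rw [h.add_add_add_comm]
  exact h.basic.b8 _ _

theorem add_lt_add_of_le_of_lt {a b c d : 𝓜.Num} (hab : 𝓜.le a b) (hcd : 𝓜.lt c d) :
    𝓜.lt (𝓜.add a c) (𝓜.add b d) := by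
  refine ⟨h.add_le_add hab hcd.1, fun he => ?_⟩
  obtain ⟨e, rfl⟩ := h.exists_add_of_le hab
  obtain ⟨f, rfl⟩ := h.exists_add_of_le hcd.1
  rw [h.add_add_add_comm] at he
  have hef := h.add_left_cancel ((h.basic.b3 _).trans he)
  have hf : f = 𝓜.zero := h.basic.le_zero (by rw [hef, h.add_comm]; exact h.basic.b8 _ _)
  exact hcd.2 (by rw [hf, h.basic.b3])

omit [Nonempty 𝓜.Str] in
theorem succ_le_succ {x y : 𝓜.Num} (hxy : 𝓜.le x y) : 𝓜.le (𝓜.succ x) (𝓜.succ y) :=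
  h.basic.succ_le_of_lt ((h.basic.b11 _ _).1 hxy)

theorem mul_le_mul_left (x : 𝓜.Num) {y z : 𝓜.Num} (hyz : 𝓜.le y z) :
    𝓜.le (𝓜.mul x y) (𝓜.mul x z) := by
  obtain ⟨w, rfl⟩ := h.exists_add_of_le hyz
  have := h.induction (φ := .le (.mul (.var 1) (.var 2)) (.mul (.var 1) (.add (.var 2) (.var 0))))
    trivial 0 (fun n => if n = 1 then x else y) (fun _ => Classical.arbitrary _)
  simp only [Sat, termVal, Function.update_self, ne_eq, one_ne_zero,
    not_false_eq_true, Function.update_of_ne, OfNat.ofNat_ne_zero, OfNat.ofNat_ne_one, if_true,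
    if_false] at this
  refine this ?_ ?_ w
  · rw [h.basic.b3]
    exact h.basic.le_refl _
  · intro n hn
    rw [h.basic.b4, h.basic.b6]
    exact h.le_trans hn (h.basic.b8 _ _)

theorem mul_le_mul_right {x y : 𝓜.Num} (hxy : 𝓜.le x y) (z : 𝓜.Num) :
    𝓜.le (𝓜.mul x z) (𝓜.mul y z) := by
  have := h.induction (φ := .le (.mul (.var 1) (.var 0)) (.mul (.var 2) (.var 0)))
    trivial 0 (fun n => if n = 1 then x else y) (fun _ => Classical.arbitrary _)
  simp only [Sat, termVal, Function.update_self, ne_eq, one_ne_zero,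
    not_false_eq_true, Function.update_of_ne, OfNat.ofNat_ne_zero, OfNat.ofNat_ne_one, if_true,
    if_false] at this
  refine this ?_ ?_ z
  · rw [h.basic.b5, h.basic.b5]
    exact h.basic.le_refl _
  · intro n hn
    rw [h.basic.b6, h.basic.b6]
    exact h.add_le_add hn hxy

theorem mul_le_mul {a b c d : 𝓜.Num} (hab : 𝓜.le a b) (hcd : 𝓜.le c d) :
    𝓜.le (𝓜.mul a c) (𝓜.mul b d) :=
  h.le_trans (h.mul_le_mul_left a hcd) (h.mul_le_mul_right hab d)

/-- Strictness comes from the summand `2y` alone, so weak monotonicity of the product suffices. -/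
theorem pair_lt_pair (i : 𝓜.Num) {x y : 𝓜.Num} (hxy : 𝓜.lt x y) :
    𝓜.lt (𝓜.pair i x) (𝓜.pair i y) := by
  have hadd := h.add_le_add (h.basic.le_refl i) hxy.1
  exact h.add_lt_add_of_le_of_lt (h.mul_le_mul hadd (h.succ_le_succ hadd))
    (h.add_lt_add_of_le_of_lt hxy.1 hxy)

theorem pair_right_injective {i x y : 𝓜.Num} (hxy : 𝓜.pair i x = 𝓜.pair i y) : x = y := by
  by_contra hne
  rcases h.basic.b10 x y with hle | hle
  · exact (h.pair_lt_pair i ⟨hle, hne⟩).2 hxy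
  · exact (h.pair_lt_pair i ⟨hle, Ne.symm hne⟩).2 hxy.symm

/-- Used to bound the value of a quantifier bound at the actual lengths by its value at the domains
of the names. -/
theorem termVal_le_termVal (ν : ℕ → 𝓜.Num) (t : NTerm) {l l' : ℕ → 𝓜.Num}
    (hl : ∀ X ∈ t.lenVars, 𝓜.le (l X) (l' X)) : 𝓜.le (𝓜.termVal ν l t) (𝓜.termVal ν l' t) := by
  induction t with
  | var x => exact h.basic.le_refl _
  | zero => exact h.basic.le_refl _
  | succ t ih => exact h.succ_le_succ (ih hl)
  | add t s iht ihs =>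
    exact h.add_le_add (iht fun X hX => hl X (Finset.mem_union_left _ hX))
      (ihs fun X hX => hl X (Finset.mem_union_right _ hX))
  | mul t s iht ihs =>
    exact h.mul_le_mul (iht fun X hX => hl X (Finset.mem_union_left _ hX))
      (ihs fun X hX => hl X (Finset.mem_union_right _ hX))
  | len X => exact hl X (Finset.mem_singleton_self X)

omit [Nonempty 𝓜.Str] in
/-- Every string is the row `i` of some array. -/
theorem exists_isRow (i : 𝓜.Num) (X : 𝓜.Str) : ∃ S, 𝓜.IsRow S i X := by
  have : Nonempty 𝓜.Str := ⟨X⟩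
  have hb := h.basic
  -- `S = {⟨i, y⟩ : y ∈ X}`; the bound `⟨i, |X|⟩` exceeds all these pairs by monotonicity of
  -- pairing.
  obtain ⟨S, hSle, hS⟩ := h.comp
    (.exB 1 (.len 0) (.and (.eqN (.var 0)
      (.add (.mul (.add (.var 2) (.var 1)) (.succ (.add (.var 2) (.var 1))))
        (.add (.var 1) (.var 1)))) (.mem (.var 1) 0))) ⟨trivial, trivial⟩ 0
    (fun _ => i) (fun _ => X) (𝓜.pair i (𝓜.len X))
  simp only [Sat, termVal, Function.update_self, ne_eq, zero_ne_one,
    not_false_eq_true, Function.update_of_ne, OfNat.ofNat_ne_zero, OfNat.ofNat_ne_one] at hS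
  refine ⟨S, fun j => ⟨fun hj => ?_, fun hj => ?_⟩⟩
  · have hlt := hb.l1 _ _ hj
    exact (hS _ (h.pair_lt_pair i hlt)).2 ⟨j, hlt, rfl, hj⟩
  · obtain ⟨k, -, hk, hkX⟩ := (hS _ (h.lt_of_lt_of_le (hb.l1 _ _ hj) hSle)).1 hj
    rwa [h.pair_right_injective hk]

end Arithmetic

end ModelsV0

theorem termVal_congr (ν : ℕ → 𝓜.Num) (t : NTerm) {l l' : ℕ → 𝓜.Num}
    (hl : ∀ X ∈ t.lenVars, l X = l' X) : 𝓜.termVal ν l t = 𝓜.termVal ν l' t := by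
  induction t with
  | var x => rfl
  | zero => rfl
  | succ t ih => exact congrArg _ (ih hl)
  | add t s iht ihs =>
    exact congrArg₂ 𝓜.add (iht fun X hX => hl X (Finset.mem_union_left _ hX))
      (ihs fun X hX => hl X (Finset.mem_union_right _ hX))
  | mul t s iht ihs =>
    exact congrArg₂ 𝓜.mul (iht fun X hX => hl X (Finset.mem_union_left _ hX))
      (ihs fun X hX => hl X (Finset.mem_union_right _ hX))
  | len X => exact hl X (Finset.mem_singleton_self X)

end TwoSorted

/-! ### Renaming of variables -/

def NTerm.rename (f g : ℕ → ℕ) : NTerm → NTerm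
  | .var x => .var (f x)
  | .zero => .zero
  | .succ t => .succ (t.rename f g)
  | .add t s => .add (t.rename f g) (s.rename f g)
  | .mul t s => .mul (t.rename f g) (s.rename f g)
  | .len X => .len (g X)

/-- Renaming of all (free and bound) number variables by `f` and string variables by `g`. -/
def Fml.rename (f g : ℕ → ℕ) : Fml → Fml
  | .le t s => .le (t.rename f g) (s.rename f g)
  | .eqN t s => .eqN (t.rename f g) (s.rename f g)
  | .eqS X Y => .eqS (g X) (g Y)
  | .mem t X => .mem (t.rename f g) (g X)
  | .not φ => .not (φ.rename f g)
  | .and φ ψ => .and (φ.rename f g) (ψ.rename f g)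
  | .or φ ψ => .or (φ.rename f g) (ψ.rename f g)
  | .exB x t φ => .exB (f x) (t.rename f g) (φ.rename f g)
  | .allB x t φ => .allB (f x) (t.rename f g) (φ.rename f g)
  | .exN x φ => .exN (f x) (φ.rename f g)
  | .allN x φ => .allN (f x) (φ.rename f g)
  | .exS X φ => .exS (g X) (φ.rename f g)
  | .allS X φ => .allS (g X) (φ.rename f g)

namespace TwoSorted

variable {𝓜 : TwoSorted.{u, v}}

theorem termVal_rename (f g : ℕ → ℕ) (t : NTerm) (ν l : ℕ → 𝓜.Num) :
    𝓜.termVal ν l (t.rename f g) = 𝓜.termVal (ν ∘ f) (l ∘ g) t := by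
  induction t with
  | var x => rfl
  | zero => rfl
  | succ t ih => exact congrArg _ ih
  | add t s iht ihs => exact congrArg₂ _ iht ihs
  | mul t s iht ihs => exact congrArg₂ _ iht ihs
  | len X => rfl

/-- Injectivity prevents capture: updating an assignment commutes with composing it with the
renaming. -/
theorem sat_rename {f g : ℕ → ℕ} (hf : f.Injective) (hg : g.Injective) (φ : Fml)
    (ν : ℕ → 𝓜.Num) (σ : ℕ → 𝓜.Str) :
    𝓜.Sat (φ.rename f g) ν σ ↔ 𝓜.Sat φ (ν ∘ f) (σ ∘ g) := by
  have hl : ∀ σ : ℕ → 𝓜.Str,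
    (fun X => 𝓜.len (σ X)) ∘ g = fun X => 𝓜.len ((σ ∘ g) X) := fun _ => rfl
  induction φ generalizing ν σ with
  | le t s => simp only [Fml.rename, Sat, termVal_rename, hl]
  | eqN t s => simp only [Fml.rename, Sat, termVal_rename, hl]
  | eqS X Y => rfl
  | mem t X => simp only [Fml.rename, Sat, termVal_rename, hl, Function.comp_apply]
  | not φ ih => simp only [Fml.rename, Sat, ih]
  | and φ ψ ih ih' => simp only [Fml.rename, Sat, ih, ih']
  | or φ ψ ih ih' => simp only [Fml.rename, Sat, ih, ih']
  | exB x t φ ih =>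
    simp only [Fml.rename, Sat, ih, termVal_rename, hl, Function.update_comp_eq_of_injective _ hf]
  | allB x t φ ih =>
    simp only [Fml.rename, Sat, ih, termVal_rename, hl, Function.update_comp_eq_of_injective _ hf]
  | exN x φ ih => simp only [Fml.rename, Sat, ih, Function.update_comp_eq_of_injective _ hf]
  | allN x φ ih => simp only [Fml.rename, Sat, ih, Function.update_comp_eq_of_injective _ hf]
  | exS x φ ih => simp only [Fml.rename, Sat, ih, Function.update_comp_eq_of_injective _ hg]
  | allS x φ ih => simp only [Fml.rename, Sat, ih, Function.update_comp_eq_of_injective _ hg]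

/-- If `R` is definable, then so is the class of the `X` that are `R`-related to `B` or to one of
the first `a` rows of `S`. -/
theorem DefinableStr₂.exists_row {R : 𝓜.Str → 𝓜.Str → Prop} (hR : 𝓜.DefinableStr₂ R)
    (B S : 𝓜.Str) (a : 𝓜.Num) :
    𝓜.DefinableStr fun X => ∃ Y, (Y = B ∨ ∃ i, 𝓜.lt i a ∧ 𝓜.IsRow S i Y) ∧ R X Y := by
  obtain ⟨φ, ν, σ, hφ⟩ := hR
  -- The string variables `0`, `1` stay in place, while `2`, `3` become free for `B` and `S`;
  -- shifting number variables by `3` frees `0` for `a` and `1`, `2` for the row and column indices.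
  set g : ℕ → ℕ := fun n => if n < 2 then n else n + 2 with hg
  have hginj : g.Injective := by
    intro m n hmn
    simp only [hg] at hmn
    split_ifs at hmn <;> omega
  have hfinj : Function.Injective fun n : ℕ => n + 3 := add_left_injective 3
  let pairT : NTerm := .add (.mul (.add (.var 1) (.var 2)) (.succ (.add (.var 1) (.var 2))))
    (.add (.var 2) (.var 2))
  refine ⟨.exS 1 (.and (.or (.eqS 1 2) (.exB 1 (.var 0) (.allN 2
    (.or (.and (.mem (.var 2) 1) (.mem pairT 3))
      (.and (.not (.mem (.var 2) 1)) (.not (.mem pairT 3))))))) (φ.rename (fun n => n + 3) g)),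
    fun n => if n < 3 then a else ν (n - 3),
    fun n => if n = 2 then B else if n = 3 then S else σ (n - 2), fun X => ?_⟩
  simp only [Sat, sat_rename hfinj hginj]
  refine exists_congr fun Y => and_congr ?_ ?_
  · simp only [termVal, pairT, Function.update_self, ne_eq, OfNat.ofNat_ne_zero, OfNat.ofNat_ne_one,
      not_false_eq_true, Function.update_of_ne, OfNat.one_ne_ofNat,
      ← iff_iff_and_or_not_and_not]
    rfl
  · rw [hφ]
    refine iff_of_eq (congrArg₂ _ ?_ ?_)
    · funext n
      simp
    · funext n
      rcases n with _ | _ | n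
      · simp [hg]
      · simp [hg]
      · simp [hg, Function.update_of_ne]

end TwoSorted

/-! ### Boolean algebra -/

section BooleanAlgebra

variable {B : Type w} [BooleanAlgebra B] {ι : Type*} {p : ι → Prop} {F : ι → B} {b : B}

theorem isLUB_compl_of_isGLB (h : IsGLB {c | ∃ a, p a ∧ c = F a} b) :
    IsLUB {c | ∃ a, p a ∧ c = (F a)ᶜ} bᶜ := by
  constructor
  · rintro _ ⟨a, ha, rfl⟩
    exact compl_le_compl (h.1 ⟨a, ha, rfl⟩)
  · intro u hu
    refine compl_le_iff_compl_le.1 (h.2 ?_)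
    rintro _ ⟨a, ha, rfl⟩
    exact compl_le_iff_compl_le.1 (hu ⟨a, ha, rfl⟩)

/-- `𝔹` need not be complete, but `c ⊓ ·` has the right adjoint `c ⇨ ·` and so preserves every join
that exists. -/
theorem isLUB_inf_left (c : B) (h : IsLUB {d | ∃ a, p a ∧ d = F a} b) :
    IsLUB {d | ∃ a, p a ∧ d = c ⊓ F a} (c ⊓ b) := by
  constructor
  · rintro _ ⟨a, ha, rfl⟩
    exact inf_le_inf_left c (h.1 ⟨a, ha, rfl⟩)
  · intro u hu
    rw [inf_comm, ← le_himp_iff]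
    refine h.2 ?_
    rintro _ ⟨a, ha, rfl⟩
    rw [le_himp_iff, inf_comm]
    exact hu ⟨a, ha, rfl⟩

end BooleanAlgebra

namespace InternalBA

variable {𝓜 : TwoSorted.{u, v}} {B : Type w} [BooleanAlgebra B] {P : InternalBA 𝓜 B}

theorem nonempty_str (P : InternalBA 𝓜 B) : Nonempty 𝓜.Str := ⟨(P.surj ⊥).choose⟩

/-! ### Uniqueness of Boolean values -/

theorem IsLenValue.unique {vs : Finset ℕ} {σ : ℕ → P.Name} {α : (ℕ → 𝓜.Num) → B} {b c : B}
    (hb : IsLenValue vs σ α b) (hc : IsLenValue vs σ α c) : b = c := by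
  obtain ⟨W, hW, hb⟩ := hb
  obtain ⟨W', hW', hc⟩ := hc
  obtain rfl : W = W' := funext fun l => (hW l).unique (hW' l)
  exact hb.unique hc

theorem IsLenValue.eq_of_empty {σ : ℕ → P.Name} {α : (ℕ → 𝓜.Num) → B} {b c : B}
    (hb : IsLenValue ∅ σ α b) (hα : ∀ l, α l = c) : b = c := by
  refine hb.unique ⟨fun _ => ⊤, fun l => ?_, ?_⟩
  · simp
  · constructor
    · rintro _ ⟨l, -, rfl⟩
      simp [hα]
    · intro u hu
      refine hu ⟨fun _ => 𝓜.zero, by simp, ?_⟩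
      simp [hα]

/-- Lets values coming from separate applications of admissibility be identified. The functions `f`,
`g` of a quantifier are arbitrary beyond the bound, but do not enter the join or meet there. -/
theorem IsValue.unique {φ : Fml} {ν : ℕ → 𝓜.Num} {σ : ℕ → P.Name} {b c : B}
    (hb : IsValue φ ν σ b) (hc : IsValue φ ν σ c) : b = c := by
  induction φ generalizing ν b c with
  | le t s => exact IsLenValue.unique hb hc
  | eqN t s => exact IsLenValue.unique hb hc
  | eqS X Y => exact IsGLB.unique hb hc
  | mem t X => exact IsLenValue.unique hb hc
  | not φ ih =>
    obtain ⟨b, hb, rfl⟩ := hb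
    obtain ⟨c, hc, rfl⟩ := hc
    rw [ih hb hc]
  | and φ ψ ih ih' =>
    obtain ⟨b, b', hb, hb', rfl⟩ := hb
    obtain ⟨c, c', hc, hc', rfl⟩ := hc
    rw [ih hb hc, ih' hb' hc']
  | or φ ψ ih ih' =>
    obtain ⟨b, b', hb, hb', rfl⟩ := hb
    obtain ⟨c, c', hc, hc', rfl⟩ := hc
    rw [ih hb hc, ih' hb' hc']
  | exB x t φ ih =>
    obtain ⟨f, g, hfg, hb⟩ := hb
    obtain ⟨f', g', hfg', hc⟩ := hc
    refine hb.unique ?_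
    convert hc using 5 with d a
    refine and_congr_right fun ha => ?_
    rw [(hfg a ha).1.unique (hfg' a ha).1, ih (hfg a ha).2 (hfg' a ha).2]
  | allB x t φ ih =>
    obtain ⟨f, g, hfg, hb⟩ := hb
    obtain ⟨f', g', hfg', hc⟩ := hc
    refine hb.unique ?_
    convert hc using 5 with d a
    refine and_congr_right fun ha => ?_
    rw [(hfg a ha).1.unique (hfg' a ha).1, ih (hfg a ha).2 (hfg' a ha).2]
  | exN x φ ih => exact hb.elim
  | allN x φ ih => exact hb.elim
  | exS x φ ih => exact hb.elim
  | allS x φ ih => exact hb.elim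

theorem IsValue.mem_var {x X : ℕ} {ν : ℕ → 𝓜.Num} {σ : ℕ → P.Name} {b : B}
    (hb : IsValue (.mem (.var x) X) ν σ b) : b = (σ X).toFun (ν x) :=
  IsLenValue.eq_of_empty hb fun _ => rfl

/-! ### Elements of `M^𝔹` -/

theorem exists_name_zero (h : 𝓜.ModelsV0) (P : InternalBA 𝓜 B) (b : B) :
    ∃ A : P.Name, A.dom = 𝓜.one ∧ A.toFun 𝓜.zero = b := by
  classical
  obtain ⟨X, hX, rfl⟩ := P.surj b
  obtain ⟨S, hS⟩ := h.exists_isRow 𝓜.zero X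
  have h0 : ∀ i, 𝓜.lt i 𝓜.one ↔ i = 𝓜.zero := fun i => by
    rw [TwoSorted.one, ← h.basic.b11]
    exact ⟨h.basic.le_zero, fun hi => hi ▸ h.basic.le_refl _⟩
  refine ⟨⟨𝓜.one, fun i => if i = 𝓜.zero then P.val X else ⊥, ⟨S, fun i hi => ?_⟩,
    fun i hi => if_neg fun hc => hi ((h0 i).2 hc)⟩, rfl, if_pos rfl⟩
  obtain rfl := (h0 i).1 hi
  exact ⟨X, hS, hX, (if_pos rfl).symm⟩

/-! ### Names and joins obtained by evaluating formulas -/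

section Translation

variable (hP : P.AdmitsSigmaB0Translation)
include hP

theorem AdmitsSigmaB0Translation.exists_name_inf (A C : P.Name) :
    ∃ F : P.Name, F.dom = A.dom ∧
      ∀ i, 𝓜.lt i A.dom → F.toFun i = C.toFun 𝓜.zero ⊓ A.toFun i := by
  obtain ⟨F, hF, hval⟩ := hP.value (.and (.mem (.var 1) 1) (.mem (.var 0) 0)) ⟨trivial, trivial⟩ 0
    (fun _ => 𝓜.zero) (fun n => if n = 0 then A else C) A.dom
  refine ⟨F, hF, fun i hi => ?_⟩
  obtain ⟨c, d, hc, hd, he⟩ := hval i hi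
  rw [he, hc.mem_var, hd.mem_var]
  simp

theorem AdmitsSigmaB0Translation.exists_isLUB (h : 𝓜.IsBasic) (A : P.Name) :
    ∃ b, IsLUB {c | ∃ i, 𝓜.lt i A.dom ∧ c = A.toFun i} b := by
  -- The bound is a number parameter, so `⟦x < t⟧ = 1` in its range; the variable `2` is a dummy,
  -- instantiated only at `0`.
  obtain ⟨F, -, hF⟩ := hP.value (.exB 0 (.var 1) (.mem (.var 0) 0)) trivial 2
    (fun _ => A.dom) (fun _ => A) 𝓜.one
  obtain ⟨f, g, hfg, hlub⟩ := hF 𝓜.zero (h.lt_succ_self _)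
  refine ⟨F.toFun 𝓜.zero, ?_⟩
  convert hlub using 5 with d a
  simp only [TwoSorted.termVal, ne_eq, OfNat.one_ne_ofNat, not_false_eq_true,
    Function.update_of_ne] at hfg ⊢
  refine and_congr_right fun ha => ?_
  obtain ⟨hf, hg⟩ := hfg a ha
  rw [hf.eq_of_empty (c := ⊤) fun l => if_pos ha, hg.mem_var, top_inf_eq, Function.update_self]

theorem AdmitsSigmaB0Translation.exists_name_len (h : 𝓜.IsBasic) (A : P.Name) :
    ∃ F : P.Name, F.dom = 𝓜.succ A.dom ∧
      ∀ l, 𝓜.le l A.dom → IsGLB (lenConds A l) (F.toFun l) := by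
  obtain ⟨F, hF, hval⟩ := hP.value (.eqN (.len 0) (.var 1)) trivial 1
    (fun _ => 𝓜.zero) (fun _ => A) (𝓜.succ A.dom)
  refine ⟨F, hF, fun i hi => ?_⟩
  obtain ⟨W, hW, hlub⟩ := hval i ((h.b11 _ _).1 hi)
  have hset : ∀ l : ℕ → 𝓜.Num, {c | ∃ X ∈ NTerm.lenVars (.len 0) ∪ NTerm.lenVars (.var 1),
      c ∈ lenConds A (l X)} = lenConds A (l 0) := fun l => by
    ext c
    simp [NTerm.lenVars]
  have hWi : IsGLB (lenConds A i) (W fun _ => i) := by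
    have := hW fun _ => i
    rwa [hset] at this
  convert hWi using 1
  -- In the join defining `⟦|A| = i⟧` every term with a length other than `i` is `⊥`.
  refine hlub.unique ⟨?_, fun u hu => hu ⟨fun _ => i, fun _ _ => hi, ?_⟩⟩
  · rintro _ ⟨l, -, rfl⟩
    by_cases hl : l 0 = i
    · have := hW l
      rw [hset, hl] at this
      rw [this.unique hWi]
      exact inf_le_left
    · simp [truth, TwoSorted.termVal, hl]
  · simp [truth, TwoSorted.termVal]

end Translation

/-! ### Generic filters -/

section Generic

variable (h : 𝓜.ModelsV0) (hP : P.AdmitsSigmaB0Translation) {I : Order.Ideal B}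
  (hI : P.IsM0Complete I) {G : Order.PFilter B} (hG : P.IsGeneric I G)
include h hP hI hG

/-- The only appeal to density: the set met by `G` is definable through the rows of a code of `A`,
and dense by `M₀`-completeness of `I`. -/
theorem IsGeneric.compl_mem_or (A : P.Name) {b : B}
    (hb : IsLUB {c | ∃ i, 𝓜.lt i A.dom ∧ c = A.toFun i} b) :
    bᶜ ∈ G ∨ ∃ i, 𝓜.lt i A.dom ∧ A.toFun i ∈ G := by
  obtain ⟨S, hS⟩ := A.coded
  obtain ⟨Y, hY, hYb⟩ := P.surj bᶜ
  have hdef := P.le_definable.exists_row Y S A.dom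
  obtain ⟨c, hc, -, hcG⟩ := hG.meets {c | c ≤ bᶜ ∨ ∃ i, 𝓜.lt i A.dom ∧ c ≤ A.toFun i} (by
    refine (congrArg 𝓜.DefinableStr (funext fun X => propext ?_)).mp hdef
    constructor
    · rintro ⟨Z, rfl | ⟨i, hi, hZ⟩, hX, -, hle⟩
      · exact ⟨hX, Or.inl (hYb ▸ hle)⟩
      · obtain ⟨Z', hZ', -, hval⟩ := hS i hi
        obtain rfl : Z = Z' := h.basic.str_ext fun j => (hZ j).trans (hZ' j).symm
        exact ⟨hX, Or.inr ⟨i, hi, hval ▸ hle⟩⟩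
    · rintro ⟨hX, hle | ⟨i, hi, hle⟩⟩
      · exact ⟨Y, Or.inl rfl, hX, hY, hYb ▸ hle⟩
      · obtain ⟨Z, hZ, hc, hval⟩ := hS i hi
        exact ⟨Z, Or.inr ⟨i, hi, hZ⟩, hX, hc, hval ▸ hle⟩) (by
    intro c hc
    by_contra! hno
    have h1 : c ⊓ bᶜ ∈ I := by
      by_contra hmem
      exact hno _ (Or.inl inf_le_right) hmem inf_le_left
    have h2 : c ⊓ b ∈ I := by
      obtain ⟨C, -, rfl⟩ := exists_name_zero h P c
      obtain ⟨F, hF, hval⟩ := hP.exists_name_inf A C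
      have hlub := isLUB_inf_left (C.toFun 𝓜.zero) hb
      refine hI.complete F (fun i hi => ?_) _ ?_
      · rw [hF] at hi
        rw [hval i hi]
        by_contra hmem
        exact hno _ (Or.inr ⟨i, hi, inf_le_right⟩) hmem inf_le_left
      · convert hlub using 5 with d a
        rw [hF]
        exact and_congr_right fun ha => by rw [hval a ha]
    have := Order.Ideal.sup_mem h2 h1
    -- `c = (c ⊓ b) ⊔ (c ⊓ bᶜ)` would lie in `I`.
    rw [← inf_sup_left, sup_compl_eq_top, inf_top_eq] at this
    exact hc this)
  rcases hc with hc | ⟨i, hi, hc⟩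
  · exact Or.inl (Order.PFilter.mem_of_le hc hcG)
  · exact Or.inr ⟨i, hi, Order.PFilter.mem_of_le hc hcG⟩

theorem IsGeneric.compl_mem_iff {b : B} : bᶜ ∈ G ↔ b ∉ G := by
  constructor
  · intro hc hb
    have := Order.PFilter.inf_mem hb hc
    rw [inf_compl_eq_bot] at this
    exact hG.proper this
  · intro hb
    obtain ⟨A, hA, rfl⟩ := exists_name_zero h P b
    have h0 : ∀ i, 𝓜.lt i A.dom ↔ i = 𝓜.zero := fun i => by
      rw [hA, TwoSorted.one, ← h.basic.b11]
      exact ⟨h.basic.le_zero, fun hi => hi ▸ h.basic.le_refl _⟩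
    refine (hG.compl_mem_or h hP hI A (b := A.toFun 𝓜.zero) ?_).resolve_right ?_
    · simp [h0]
    · rintro ⟨i, hi, hiG⟩
      exact hb ((h0 i).1 hi ▸ hiG)

theorem IsGeneric.exists_mem_of_isLUB (A : P.Name) {b : B}
    (hb : IsLUB {c | ∃ i, 𝓜.lt i A.dom ∧ c = A.toFun i} b) (hbG : b ∈ G) :
    ∃ i, 𝓜.lt i A.dom ∧ A.toFun i ∈ G :=
  (hG.compl_mem_or h hP hI A hb).resolve_left fun hc => (hG.compl_mem_iff h hP hI).1 hc hbG

theorem IsGeneric.sup_mem_iff {b c : B} : b ⊔ c ∈ G ↔ b ∈ G ∨ c ∈ G := by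
  have := hG.compl_mem_iff h hP hI (b := b ⊔ c)
  rw [compl_sup, Order.PFilter.inf_mem_iff, hG.compl_mem_iff h hP hI,
    hG.compl_mem_iff h hP hI] at this
  tauto

omit h hP hI in
theorem IsGeneric.truth_mem_iff {p : Prop} : truth B p ∈ G ↔ p := by
  by_cases hp : p
  · simp [truth, hp]
  · simpa [truth, hp] using hG.proper

omit h hP hI in
theorem IsGeneric.mem_interp {A : P.Name} {y : 𝓜.Num} : y ∈ interp G A ↔ A.toFun y ∈ G := by
  refine ⟨fun hy => hy.2, fun hy => ⟨?_, hy⟩⟩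
  by_contra hlt
  exact hG.proper (A.outside y hlt ▸ hy)

/-! ### Lengths -/

omit h hP hI hG in
theorem setLen_empty : setLen 𝓜 ∅ = 𝓜.zero := dif_neg (by simp)

omit hP hI hG in
theorem setLen_eq_succ {S : Set 𝓜.Num} {k : 𝓜.Num} (hk : k ∈ S) (hmax : ∀ y ∈ S, 𝓜.le y k) :
    setLen 𝓜 S = 𝓜.succ k := by
  have hex : ∃ m, m ∈ S ∧ ∀ y ∈ S, 𝓜.le y m := ⟨k, hk, hmax⟩
  rw [setLen, dif_pos hex]
  exact congrArg _ (h.basic.b7 _ _ (hmax _ hex.choose_spec.1) (hex.choose_spec.2 k hk))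

/-- The Boolean length of `A` is decided by `G`. -/
theorem IsGeneric.exists_len (A : P.Name) :
    𝓜.le (setLen 𝓜 (interp G A)) A.dom ∧
      (∀ y ∈ interp G A, 𝓜.lt y (setLen 𝓜 (interp G A))) ∧
      (∀ y, 𝓜.succ y = setLen 𝓜 (interp G A) → y ∈ interp G A) ∧
      ∃ c ∈ G, IsGLB (lenConds A (setLen 𝓜 (interp G A))) c := by
  have hb := h.basic
  obtain ⟨F, hF, hval⟩ := hP.exists_name_len hb A
  have hlub : IsLUB {c | ∃ l, 𝓜.lt l F.dom ∧ c = F.toFun l} (⊤ : B) := by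
    convert hP.length A using 5 with c l
    rw [hF, ← hb.b11]
    exact and_congr_right fun hl => ⟨fun hc => hc ▸ hval l hl, fun hc => hc.unique (hval l hl)⟩
  obtain ⟨l, hl, hlG⟩ := hG.exists_mem_of_isLUB h hP hI F hlub Order.PFilter.top_mem
  rw [hF, ← hb.b11] at hl
  have hconds : ∀ c ∈ lenConds A l, c ∈ G := fun c hc =>
    Order.PFilter.mem_of_le ((hval l hl).1 hc) hlG
  have hlt : ∀ y ∈ interp G A, 𝓜.lt y l := by
    intro y hy
    rw [← hb.not_le]
    intro hly
    exact (hG.compl_mem_iff h hP hI).1 (hconds _ (Or.inr ⟨y, hly, hy.1, rfl⟩)) hy.2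
  have hmem : ∀ y, 𝓜.succ y = l → y ∈ interp G A := fun y hy =>
    hG.mem_interp.2 (hconds _ (Or.inl ⟨y, hy, rfl⟩))
  have hlen : setLen 𝓜 (interp G A) = l := by
    by_cases h0 : l = 𝓜.zero
    · have : interp G A = ∅ := Set.eq_empty_of_forall_notMem fun y hy =>
        hb.not_lt_zero y (h0 ▸ hlt y hy)
      rw [this, setLen_empty, h0]
    · obtain ⟨k, -, rfl⟩ := hb.b12 l h0
      exact setLen_eq_succ h (hmem k rfl) fun y hy => (hb.b11 _ _).2 (hlt y hy)
  rw [hlen]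
  exact ⟨hl, hlt, hmem, _, hlG, hval l hl⟩

omit hP hI hG in
-- Different lengths are incompatible: for `l < l' = k + 1`, length `l'` requires `A(k)`, while
-- length `l` requires `¬A(k)` or has `A(k) = ⊥` outside the domain.
theorem eq_bot_of_mem_lowerBounds_lenConds {A : P.Name} {l l' : 𝓜.Num} {c : B}
    (hc : c ∈ lowerBounds (lenConds A l)) (hc' : c ∈ lowerBounds (lenConds A l'))
    (hne : l ≠ l') : c = ⊥ := by
  have hb := h.basic
  wlog hle : 𝓜.le l l' generalizing l l'
  · exact this hc' hc hne.symm ((hb.b10 l l').resolve_left hle)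
  have h0 : l' ≠ 𝓜.zero := by
    rintro rfl
    exact hne (hb.le_zero hle)
  obtain ⟨k, -, rfl⟩ := hb.b12 l' h0
  have h1 : c ≤ A.toFun k := hc' (Or.inl ⟨k, rfl, rfl⟩)
  by_cases hk : 𝓜.lt k A.dom
  · have h2 : c ≤ (A.toFun k)ᶜ := hc (Or.inr ⟨k, (hb.b11 _ _).2 ⟨hle, hne⟩, hk, rfl⟩)
    exact le_bot_iff.1 (inf_compl_eq_bot (a := A.toFun k) ▸ le_inf h1 h2)
  · exact le_bot_iff.1 (A.outside k hk ▸ h1)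

/-- Below some element of `G`, the Boolean value of an atomic formula is its value at the actual
lengths. -/
theorem IsGeneric.exists_mem_isLenValue (vs : Finset ℕ) (σ : ℕ → P.Name) :
    ∃ τ ∈ G, ∀ (α : (ℕ → 𝓜.Num) → B) (b : B),
      (∀ l l', (∀ X ∈ vs, l X = l' X) → α l = α l') → IsLenValue vs σ α b →
      b ⊓ τ ≤ α (fun X => setLen 𝓜 (interp G (σ X))) ∧
      α (fun X => setLen 𝓜 (interp G (σ X))) ⊓ τ ≤ b := by
  -- `τ` is the finite meet of the values `⟦|σ X| = ℓ⟧` at the actual lengths; it does not depend on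
  -- `α`.
  choose F hFG hF using fun X => (hG.exists_len h hP hI (σ X)).2.2.2
  refine ⟨vs.inf F, Finset.inf_induction Order.PFilter.top_mem
    (fun a ha b hb => Order.PFilter.inf_mem ha hb) fun X _ => hFG X, ?_⟩
  rintro α b hα ⟨W, hW, hb⟩
  constructor
  · rw [← le_himp_iff]
    refine hb.2 ?_
    rintro _ ⟨l, -, rfl⟩
    rw [le_himp_iff]
    by_cases hl : ∀ X ∈ vs, l X = setLen 𝓜 (interp G (σ X))
    · rw [hα _ _ hl]
      exact inf_le_left.trans inf_le_right
    · push Not at hl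
      obtain ⟨X, hX, hne⟩ := hl
      have : W l ⊓ vs.inf F = ⊥ := by
        refine eq_bot_of_mem_lowerBounds_lenConds h (A := σ X) (fun c hc => ?_) (fun c hc => ?_) hne
        · exact inf_le_left.trans ((hW l).1 ⟨X, hX, hc⟩)
        · exact (inf_le_right.trans (Finset.inf_le hX)).trans ((hF X).1 hc)
      rw [inf_right_comm, this, bot_inf_eq]
      exact bot_le
  · refine le_trans ?_ (hb.1 ⟨_, fun X _ => (hG.exists_len h hP hI (σ X)).1, rfl⟩)
    rw [inf_comm]
    refine inf_le_inf_right _ ((hW _).2 ?_)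
    rintro c ⟨X, hX, hc⟩
    exact (Finset.inf_le hX).trans ((hF X).1 hc)

theorem IsGeneric.isLenValue_mem_iff {vs : Finset ℕ} {σ : ℕ → P.Name} {α : (ℕ → 𝓜.Num) → B} {b : B}
    (hα : ∀ l l', (∀ X ∈ vs, l X = l' X) → α l = α l') (hb : IsLenValue vs σ α b) :
    b ∈ G ↔ α (fun X => setLen 𝓜 (interp G (σ X))) ∈ G := by
  obtain ⟨τ, hτ, hle⟩ := hG.exists_mem_isLenValue h hP hI vs σ
  obtain ⟨h1, h2⟩ := hle α b hα hb
  exact ⟨fun hm => Order.PFilter.mem_of_le h1 (Order.PFilter.inf_mem hm hτ),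
    fun hm => Order.PFilter.mem_of_le h2 (Order.PFilter.inf_mem hm hτ)⟩

/-! ### Truth in the generic model -/

/-- The family `f a ⊓ g a` is not itself turned into a name: `x` may occur in `t` without being
bound there. Instead, below `τ` its join is at most the join of `⟦φ(a)⟧` over `a < s`, with `s` the
actual value of `t`, and that family is a name. -/
theorem IsGeneric.exB_mem_iff {φ : Fml} (hφ : φ.IsSigmaB0) (x : ℕ) (t : NTerm) (ν : ℕ → 𝓜.Num)
    (σ : ℕ → P.Name) {f g : 𝓜.Num → B} {b : B}
    (hfg : ∀ a, 𝓜.lt a (𝓜.termVal ν (fun X => (σ X).dom) t) →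
      IsLenValue t.lenVars σ (fun l => truth B (𝓜.lt a (𝓜.termVal ν l t))) (f a) ∧
      IsValue φ (Function.update ν x a) σ (g a))
    (hb : IsLUB {c | ∃ a, 𝓜.lt a (𝓜.termVal ν (fun X => (σ X).dom) t) ∧ c = f a ⊓ g a} b) :
    b ∈ G ↔ ∃ a, 𝓜.lt a (𝓜.termVal ν (fun X => setLen 𝓜 (interp G (σ X))) t) ∧ g a ∈ G := by
  have : Nonempty 𝓜.Str := P.nonempty_str
  set s := 𝓜.termVal ν (fun X => setLen 𝓜 (interp G (σ X))) t with hs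
  have hle : 𝓜.le s (𝓜.termVal ν (fun X => (σ X).dom) t) :=
    h.termVal_le_termVal ν t fun X _ => (hG.exists_len h hP hI (σ X)).1
  have hcongr : ∀ a l l', (∀ X ∈ t.lenVars, l X = l' X) →
      truth B (𝓜.lt a (𝓜.termVal ν l t)) = truth B (𝓜.lt a (𝓜.termVal ν l' t)) :=
    fun a l l' hl => by rw [TwoSorted.termVal_congr ν t hl]
  constructor
  · intro hbG
    obtain ⟨τ, hτ, hτle⟩ := hG.exists_mem_isLenValue h hP hI t.lenVars σ
    obtain ⟨N, hNs, hN⟩ := hP.value φ hφ x ν σ s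
    rw [← hNs] at hs hN hle ⊢
    obtain ⟨e, he⟩ := hP.exists_isLUB h.basic N
    have hbe : b ⊓ τ ≤ e := by
      rw [← le_himp_iff]
      refine hb.2 ?_
      rintro _ ⟨a, ha, rfl⟩
      obtain ⟨hf, hg⟩ := hfg a ha
      rw [le_himp_iff]
      by_cases has : 𝓜.lt a N.dom
      · rw [hg.unique (hN a has)]
        exact (inf_le_left.trans inf_le_right).trans (he.1 ⟨a, has, rfl⟩)
      -- For `a ≥ s` the value `⟦a < t⟧` is disjoint from `τ`; one `τ` serves all `a`.
      · have hfa := (hτle _ _ (hcongr a) hf).1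
        rw [← hs, truth, if_neg has, le_bot_iff] at hfa
        rw [inf_right_comm, hfa, bot_inf_eq]
        exact bot_le
    obtain ⟨a, ha, haG⟩ := hG.exists_mem_of_isLUB h hP hI N he
      (Order.PFilter.mem_of_le hbe (Order.PFilter.inf_mem hbG hτ))
    refine ⟨a, ha, ?_⟩
    rwa [(hfg a (h.lt_of_lt_of_le ha hle)).2.unique (hN a ha)]
  · rintro ⟨a, ha, haG⟩
    have ha' := h.lt_of_lt_of_le ha hle
    refine Order.PFilter.mem_of_le (hb.1 ⟨a, ha', rfl⟩) (Order.PFilter.inf_mem ?_ haG)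
    rw [hG.isLenValue_mem_iff h hP hI (hcongr a) (hfg a ha').1]
    exact hG.truth_mem_iff.2 ha

theorem IsGeneric.eqS_mem_iff (A C : P.Name) {b : B}
    (hb : IsGLB {c | ∃ j, (𝓜.lt j A.dom ∨ 𝓜.lt j C.dom) ∧
      c = (A.toFun j ⊓ C.toFun j) ⊔ ((A.toFun j)ᶜ ⊓ (C.toFun j)ᶜ)} b) :
    b ∈ G ↔ interp G A = interp G C := by
  have : Nonempty 𝓜.Str := P.nonempty_str
  have hpt : ∀ j, (A.toFun j ⊓ C.toFun j) ⊔ ((A.toFun j)ᶜ ⊓ (C.toFun j)ᶜ) ∈ G ↔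
      (j ∈ interp G A ↔ j ∈ interp G C) := fun j => by
    rw [hG.sup_mem_iff h hP hI, Order.PFilter.inf_mem_iff, Order.PFilter.inf_mem_iff,
      hG.compl_mem_iff h hP hI, hG.compl_mem_iff h hP hI, hG.mem_interp, hG.mem_interp,
      ← iff_iff_and_or_not_and_not]
  constructor
  · intro hbG
    ext j
    by_cases hj : 𝓜.lt j A.dom ∨ 𝓜.lt j C.dom
    · exact (hpt j).1 (Order.PFilter.mem_of_le (hb.1 ⟨j, hj, rfl⟩) hbG)
    · exact ⟨fun hm => (hj (Or.inl hm.1)).elim, fun hm => (hj (Or.inr hm.1)).elim⟩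
  · intro heq
    by_contra hbG
    obtain ⟨m, hm⟩ : ∃ m, ∀ j, (𝓜.lt j A.dom ∨ 𝓜.lt j C.dom) ↔ 𝓜.lt j m := by
      rcases h.basic.b10 A.dom C.dom with hle | hle
      · exact ⟨C.dom, fun j => or_iff_right_of_imp fun hj => h.lt_of_lt_of_le hj hle⟩
      · exact ⟨A.dom, fun j => or_iff_left_of_imp fun hj => h.lt_of_lt_of_le hj hle⟩
    -- If the meet is not in `G`, its complement is, as the join of the pointwise disagreements; `F`
    -- names these, so `G` contains one of them.
    obtain ⟨F, rfl, hF⟩ := hP.value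
      (.not (.or (.and (.mem (.var 0) 0) (.mem (.var 0) 1))
        (.and (.not (.mem (.var 0) 0)) (.not (.mem (.var 0) 1)))))
      ⟨⟨trivial, trivial⟩, trivial, trivial⟩ 0 (fun _ => 𝓜.zero)
      (fun n => if n = 0 then A else C) m
    have hval : ∀ j, 𝓜.lt j F.dom →
        F.toFun j = ((A.toFun j ⊓ C.toFun j) ⊔ ((A.toFun j)ᶜ ⊓ (C.toFun j)ᶜ))ᶜ := by
      intro j hj
      obtain ⟨_, ⟨_, _, ⟨_, _, h1, h2, rfl⟩, ⟨_, _, ⟨_, h3, rfl⟩, ⟨_, h4, rfl⟩, rfl⟩, rfl⟩, he⟩ :=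
        hF j hj
      rw [he, h1.mem_var, h2.mem_var, h3.mem_var, h4.mem_var]
      simp
    have hlub := isLUB_compl_of_isGLB hb
    obtain ⟨j, hj, hjG⟩ := hG.exists_mem_of_isLUB h hP hI F (b := bᶜ) (by
      convert hlub using 5 with d j
      rw [hm]
      exact and_congr_right fun hj => by rw [hval j hj]) ((hG.compl_mem_iff h hP hI).2 hbG)
    rw [hval j hj, hG.compl_mem_iff h hP hI, hpt, heq] at hjG
    exact hjG Iff.rfl

/-- The element of `M[G]` named by `A`. -/
def Name.str (G : Order.PFilter B) (A : P.Name) : (P.genericModel G).Str := ⟨interp G A, A, rfl⟩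

/-- A `Σᴮ₀` formula holds in the generic model iff its Boolean value belongs to `G`. -/
theorem IsGeneric.mem_iff_sat {φ : Fml} (hφ : φ.IsSigmaB0) (ν : ℕ → 𝓜.Num) (σ : ℕ → P.Name) {b : B}
    (hb : IsValue φ ν σ b) :
    b ∈ G ↔ (P.genericModel G).Sat φ ν fun X => (σ X).str G := by
  have hterm : ∀ (ν : ℕ → 𝓜.Num) (t : NTerm),
      (P.genericModel G).termVal ν
        (fun X => (P.genericModel G).len ((σ X).str G)) t =
      𝓜.termVal ν (fun X => setLen 𝓜 (interp G (σ X))) t := by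
    intro ν t
    induction t with
    | var x => rfl
    | zero => rfl
    | succ t ih => exact congrArg 𝓜.succ ih
    | add t s iht ihs => exact congrArg₂ 𝓜.add iht ihs
    | mul t s iht ihs => exact congrArg₂ 𝓜.mul iht ihs
    | len X => rfl
  have hlt : ∀ (ν : ℕ → 𝓜.Num) (t : NTerm) (a : 𝓜.Num),
      (P.genericModel G).lt a ((P.genericModel G).termVal ν
        (fun X => (P.genericModel G).len ((σ X).str G)) t) ↔
      𝓜.lt a (𝓜.termVal ν (fun X => setLen 𝓜 (interp G (σ X))) t) := fun ν t a =>
    iff_of_eq (congrArg (𝓜.lt a) (hterm ν t))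
  have hdom : ∀ (ν : ℕ → 𝓜.Num) (t : NTerm) (a : 𝓜.Num),
      𝓜.lt a (𝓜.termVal ν (fun X => setLen 𝓜 (interp G (σ X))) t) →
      𝓜.lt a (𝓜.termVal ν (fun X => (σ X).dom) t) := fun ν t a ha =>
    have : Nonempty 𝓜.Str := P.nonempty_str
    h.lt_of_lt_of_le ha
      (h.termVal_le_termVal ν t fun X _ => (hG.exists_len h hP hI (σ X)).1)
  induction φ generalizing ν b with
  | le t s =>
    refine (hG.isLenValue_mem_iff h hP hI (fun l l' hl => ?_) hb).trans (hG.truth_mem_iff.trans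
      (iff_of_eq (congrArg₂ 𝓜.le (hterm ν t) (hterm ν s))).symm)
    rw [TwoSorted.termVal_congr ν t fun X hX => hl X (Finset.mem_union_left _ hX),
      TwoSorted.termVal_congr ν s fun X hX => hl X (Finset.mem_union_right _ hX)]
  | eqN t s =>
    refine (hG.isLenValue_mem_iff h hP hI (fun l l' hl => ?_) hb).trans (hG.truth_mem_iff.trans
      (iff_of_eq (congrArg₂ Eq (hterm ν t) (hterm ν s))).symm)
    rw [TwoSorted.termVal_congr ν t fun X hX => hl X (Finset.mem_union_left _ hX),
      TwoSorted.termVal_congr ν s fun X hX => hl X (Finset.mem_union_right _ hX)]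
  | eqS X Y =>
    exact (hG.eqS_mem_iff h hP hI _ _ hb).trans
      (Subtype.ext_iff (a1 := (σ X).str G) (a2 := (σ Y).str G)).symm
  | mem t X =>
    refine (hG.isLenValue_mem_iff h hP hI (fun l l' hl => ?_) hb).trans (hG.mem_interp.symm.trans
      (iff_of_eq (congrArg (· ∈ interp G (σ X)) (hterm ν t))).symm)
    rw [TwoSorted.termVal_congr ν t hl]
  | not φ ih =>
    obtain ⟨c, hc, rfl⟩ := hb
    exact (hG.compl_mem_iff h hP hI).trans (not_congr (ih hφ ν hc))
  | and φ ψ ih ih' =>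
    obtain ⟨c, d, hc, hd, rfl⟩ := hb
    exact Order.PFilter.inf_mem_iff.trans (and_congr (ih hφ.1 ν hc) (ih' hφ.2 ν hd))
  | or φ ψ ih ih' =>
    obtain ⟨c, d, hc, hd, rfl⟩ := hb
    exact (hG.sup_mem_iff h hP hI).trans (or_congr (ih hφ.1 ν hc) (ih' hφ.2 ν hd))
  | exB x t φ ih =>
    obtain ⟨f, g, hfg, hb⟩ := hb
    rw [hG.exB_mem_iff h hP hI (φ := φ) hφ x t ν σ hfg hb]
    exact exists_congr fun a => (and_congr_right fun ha =>
      ih hφ _ (hfg a (hdom ν t a ha)).2).trans (and_congr_left' (hlt ν t a).symm)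
  | allB x t φ ih =>
    obtain ⟨f, g, hfg, hb⟩ := hb
    -- By duality: the complement of the meet is the join that translates `∃ x < t, ¬φ`.
    have hlub := isLUB_compl_of_isGLB hb
    simp only [compl_sup, compl_compl] at hlub
    have hiff := not_congr (hG.exB_mem_iff h hP hI (φ := .not φ) hφ x t ν σ
      (fun a ha => ⟨(hfg a ha).1, g a, (hfg a ha).2, rfl⟩) hlub)
    simp only [hG.compl_mem_iff h hP hI, not_not, not_exists, not_and] at hiff
    exact hiff.trans (forall_congr' fun a => (imp_congr_right fun ha =>
      ih hφ _ (hfg a (hdom ν t a ha)).2).trans (imp_congr_left (hlt ν t a).symm))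
  | exN x φ ih => exact hφ.elim
  | allN x φ ih => exact hφ.elim
  | exS x φ ih => exact hφ.elim
  | allS x φ ih => exact hφ.elim

/-- The axioms about numbers are inherited from `𝓜`; those about lengths rest on `exists_len`. -/
theorem IsGeneric.isBasic_genericModel : (P.genericModel G).IsBasic where
  b1 := h.basic.b1
  b2 := h.basic.b2
  b3 := h.basic.b3
  b4 := h.basic.b4
  b5 := h.basic.b5
  b6 := h.basic.b6
  b7 := h.basic.b7
  b8 := h.basic.b8
  b9 := h.basic.b9
  b10 := h.basic.b10
  b11 := h.basic.b11
  b12 := h.basic.b12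
  l1 := by
    rintro y ⟨_, A, rfl⟩ hy
    exact (hG.exists_len h hP hI A).2.1 y hy
  l2 := by
    rintro y ⟨_, A, rfl⟩ hy
    exact (hG.exists_len h hP hI A).2.2.1 y hy
  se := by
    rintro ⟨_, A, rfl⟩ ⟨_, C, rfl⟩ hlen heq
    refine Subtype.ext (Set.ext fun y => ⟨fun hy => ?_, fun hy => ?_⟩)
    · exact (heq y ((hG.exists_len h hP hI A).2.1 y hy)).1 hy
    · refine (heq y ?_).2 hy
      rw [hlen]
      exact (hG.exists_len h hP hI C).2.1 y hy

theorem IsGeneric.modelsV0_genericModel : (P.genericModel G).ModelsV0 where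
  basic := hG.isBasic_genericModel h hP hI
  comp φ hφ x ν σ a := by
    choose A hA using fun X => (σ X).2
    obtain rfl : σ = fun X => (A X).str G := funext fun X => Subtype.ext (hA X).symm
    -- `F` is `i ↦ ⟦φ(i)⟧` on `i < a`; its interpretation has length at most its domain `a`.
    obtain ⟨F, rfl, hF⟩ := hP.value φ hφ x ν A a
    exact ⟨F.str G, (hG.exists_len h hP hI F).1, fun z hz =>
      hG.mem_interp.trans (hG.mem_iff_sat h hP hI hφ _ A (hF z hz))⟩

end Generic

end InternalBA

theorem mainTheorem9 (𝓜 : TwoSorted.{u, v}) (h𝓜 : 𝓜.IsGround)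
    {B : Type w} [BooleanAlgebra B] (P : InternalBA 𝓜 B)
    (hP : P.AdmitsSigmaB0Translation)
    (I : Order.Ideal B) (hI : P.IsM0Complete I)
    (G : Order.PFilter B) (hG : P.IsGeneric I G) :
    (P.genericModel G).ModelsV0 :=
  hG.modelsV0_genericModel h𝓜.vp.1 hP hI
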